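/- Conventions. An mm-space is a complete separable metric space $(X,d_X)$ with a Borel probability measure $\mu_X$ such that $X=\operatorname{supp}\mu_X$; $\mathcal X$ denotes the set of mm-spaces up to measure-preserving isometry. Write $Y\prec X$ if there is a $1$-Lipschitz map $f:X\to Y$ with $f_*\mu_X=\mu_Y$. A parameter of $X$ is a Borel map $\varphi:[0,1)\to X$ that pushes the Lebesgue measure $\mathcal L^1$ forward to $\mu_X$. The box distance $\square(X,Y)$ is the infimum of all $\varepsilon\ge 0$ for which there are parameters $\varphi$ of $X$ and $\psi$ of $Y$ and a Borel set $I_0\subset[0,1)$ with $\mathcal L^1(I_0)\ge 1-\varepsilon$ and $|d_X(\varphi(s),\varphi(t))-d_Y(\psi(s),\psi(t))|\le\varepsilon$ for all $s,t\in I_0$. A pyramid is a nonempty $\square$-closed set $\mathcal P\subset\mathcal X$ such that $X\in\mathcal P$ and $Y\prec X$ imply $Y\in\mathcal P$, and such that any $X,X'\in\mathcal P$ admit $Y\in\mathcal P$ with $X\prec Y$ and $X'\prec Y$. Put $\square(X,\mathcal P)=\inf_{Y\in\mathcal P}\square(X,Y)$. Pyramids $\mathcal P_n$ converge weakly to a pyramid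 $\mathcal P$ if $\lim_{n\to\infty}\square(X,\mathcal P_n)=0$ for every $X\in\mathcal P$ and $\liminf_{n\to\infty}\square(X,\mathcal P_n)>0$ for every $X\in\mathcal X\setminus\mathcal P$. For an mm-space $X$ and $\kappa>0$, let $$\operatorname{ObsDiam}(X;-\kappa)=\sup_{f}\ \inf\{\operatorname{diam}A \mid A\subset\mathbb R\ \text{Borel},\ f_*\mu_X(A)\ge 1-\kappa\},$$ where $f$ runs over the $1$-Lipschitz functions $X\to\mathbb R$. For $N\ge 1$ and $\kappa_0,\dots,\kappa_N>0$, let $\operatorname{Sep}(X;\kappa_0,\dots,\kappa_N)$ be the supremum of $\min_{i\ne j}\inf_{x\in A_i,\,y\in A_j}d_X(x,y)$ over all Borel sets $A_0,\dots,A_N\subset X$ with $\mu_X(A_i)\ge\kappa_i$ for all $i$, and $0$ if there are no such sets. For a pyramid $\mathcal P$ define, with values in $[0,+\infty]$, $$\operatorname{ObsDiam}(\mathcal P;-\kappa)=\lim_{\delta\to0+}\sup_{X\in\mathcal P}\operatorname{ObsDiam}(X;-(\kappa+\delta)),$$ $$\operatorname{Sep}(\mathcal P;\kappa_0,\dots,\kappa_N)=\lim_{\delta\to0+}\sup_{X\in\mathcal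 P}\operatorname{Sep}(X;\kappa_0-\delta,\dots,\kappa_N-\delta).$$ Theorem. Let $\mathcal P$ and $\mathcal P_n$, $n=1,2,\dots$, be pyramids such that $\mathcal P_n$ converges weakly to $\mathcal P$ as $n\to\infty$. Then, in $[0,+\infty]$, $$\operatorname{ObsDiam}(\mathcal P;-\kappa)=\lim_{\varepsilon\to0+}\liminf_{n\to\infty}\operatorname{ObsDiam}(\mathcal P_n;-(\kappa+\varepsilon))=\lim_{\varepsilon\to0+}\limsup_{n\to\infty}\operatorname{ObsDiam}(\mathcal P_n;-(\kappa+\varepsilon))$$ for every $\kappa>0$, and $$\operatorname{Sep}(\mathcal P;\kappa_0,\dots,\kappa_N)=\lim_{\varepsilon\to0+}\liminf_{n\to\infty}\operatorname{Sep}(\mathcal P_n;\kappa_0-\varepsilon,\dots,\kappa_N-\varepsilon)=\lim_{\varepsilon\to0+}\limsup_{n\to\infty}\operatorname{Sep}(\mathcal P_n;\kappa_0-\varepsilon,\dots,\kappa_N-\varepsilon)$$ for every $N\ge1$ and all $\kappa_0,\dots,\kappa_N>0$ (in particular, all these limits exist). -/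

import Mathlib

open MeasureTheory Filter Topology Set
open scoped ENNReal NNReal

/-- An mm-space: a complete separable metric space with a Borel probability measure of full
support (every nonempty open set has positive measure, i.e. `X = supp μ_X`).
A separable metric space has at most the cardinality of the continuum, so
every mm-space is isomorphic to one whose carrier lives in `Type`. -/
structure MMSpace where
  carrier : Type
  [metric : MetricSpace carrier]
  [complete : CompleteSpace carrier]
  [separable : TopologicalSpace.SeparableSpace carrier]
  [measurable : MeasurableSpace carrier]
  [borel : BorelSpace carrier]
  μ : Measure carrier
  [prob : IsProbabilityMeasure μ]
  [fullSupport : μ.IsOpenPosMeasure]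

namespace MMSpace

instance : CoeSort MMSpace Type := ⟨MMSpace.carrier⟩

attribute [instance] metric complete separable measurable borel prob fullSupport

/-- `X` and `Y` are mm-isomorphic: there is a (bijective) isometry pushing `μ_X` to `μ_Y`. -/
def Iso (X Y : MMSpace) : Prop :=
  ∃ f : X ≃ᵢ Y, X.μ.map f = Y.μ

/-- The Lipschitz order `Y ≺ X`: some `1`-Lipschitz map `X → Y` pushes `μ_X` to `μ_Y`.
Here `Dom Y X` stands for `Y ≺ X`. -/
def Dom (Y X : MMSpace) : Prop :=
  ∃ f : X → Y, LipschitzWith 1 f ∧ X.μ.map f = Y.μ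

/-- The interval `I = [0,1)`. -/
abbrev UnitI : Type := Ico (0 : ℝ) 1

/-- The one-dimensional Lebesgue measure on `I = [0,1)`. -/
noncomputable def lebI : Measure UnitI := (volume : Measure ℝ).comap Subtype.val

/-- A parameter of `X`: a Borel map `φ : [0,1) → X` pushing Lebesgue measure to `μ_X`. -/
def IsParameter (X : MMSpace) (φ : UnitI → X) : Prop :=
  Measurable φ ∧ lebI.map φ = X.μ

/-- `ε` is admissible in the definition of the box distance between `X` and `Y`. -/
def BoxClose (X Y : MMSpace) (ε : ℝ≥0) : Prop :=
  ∃ (φ : UnitI → X) (ψ : UnitI → Y) (I₀ : Set UnitI),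
    X.IsParameter φ ∧ Y.IsParameter ψ ∧ MeasurableSet I₀ ∧
    (∀ s ∈ I₀, ∀ t ∈ I₀, |dist (φ s) (φ t) - dist (ψ s) (ψ t)| ≤ (ε : ℝ)) ∧
    1 - (ε : ℝ≥0∞) ≤ lebI I₀

/-- The box distance between two mm-spaces. -/
noncomputable def boxDist (X Y : MMSpace) : ℝ≥0∞ :=
  ⨅ (ε : ℝ≥0) (_ : BoxClose X Y ε), (ε : ℝ≥0∞)

/-- The box distance from an mm-space to a family of mm-spaces. -/
noncomputable def boxDistTo (X : MMSpace) (F : Set MMSpace) : ℝ≥0∞ :=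
  ⨅ Y ∈ F, boxDist X Y

/-- The partial diameter `diam(ν; α)`: the infimum of the diameters of the Borel sets of
`ν`-measure at least `α`. -/
noncomputable def partialDiam {E : Type*} [PseudoEMetricSpace E] [MeasurableSpace E]
    (ν : Measure E) (α : ℝ) : ℝ≥0∞ :=
  ⨅ (A : Set E) (_ : MeasurableSet A ∧ ENNReal.ofReal α ≤ ν A), Metric.ediam A

/-- The observable diameter `ObsDiam(X; -κ)`. -/
noncomputable def obsDiam (X : MMSpace) (κ : ℝ) : ℝ≥0∞ :=
  ⨆ (f : X → ℝ) (_ : LipschitzWith 1 f), partialDiam (X.μ.map f) (1 - κ)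

/-- The distance `d_X(A, B) = inf {d_X(x, y) | x ∈ A, y ∈ B}` between two subsets. -/
noncomputable def setDist (X : MMSpace) (A B : Set X) : ℝ≥0∞ :=
  ⨅ x ∈ A, ⨅ y ∈ B, edist x y

/-- The separation distance `Sep(X; κ₀, …, κ_N)`; it is `0` if there are no Borel sets
`A₀, …, A_N` with `μ_X(A_i) ≥ κ_i`, since a supremum over an empty family in `[0,∞]` is `0`. -/
noncomputable def sep (X : MMSpace) {N : ℕ} (κ : Fin (N + 1) → ℝ) : ℝ≥0∞ :=
  ⨆ (A : Fin (N + 1) → Set X)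
    (_ : ∀ i, MeasurableSet (A i) ∧ ENNReal.ofReal (κ i) ≤ X.μ (A i)),
    ⨅ (i : Fin (N + 1)) (j : Fin (N + 1)) (_ : i ≠ j), X.setDist (A i) (A j)

theorem obsDiam_antitone (X : MMSpace) : Antitone X.obsDiam := by
  intro a b hab
  refine iSup₂_mono fun f _ => le_iInf₂ fun A hA => iInf₂_le A ⟨hA.1, le_trans ?_ hA.2⟩
  exact ENNReal.ofReal_le_ofReal (by linarith)

theorem sep_antitone (X : MMSpace) {N : ℕ} :
    Antitone (fun κ : Fin (N + 1) → ℝ => X.sep κ) := by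
  intro a b hab
  refine iSup₂_le fun A hA => le_iSup₂_of_le A (fun i => ⟨(hA i).1, le_trans ?_ (hA i).2⟩) le_rfl
  exact ENNReal.ofReal_le_ofReal (hab i)

end MMSpace

/-- A pyramid: a nonempty, box-closed family of mm-spaces that is downward closed and directed
for the Lipschitz order. Downward closedness makes the family invariant under mm-isomorphism
(see `Pyramid.mem_iff_of_iso`), so it is the same thing as a set of isomorphism classes. -/
structure Pyramid where
  carrier : Set MMSpace
  down : ∀ X ∈ carrier, ∀ Y : MMSpace, Y.Dom X → Y ∈ carrier
  directed : ∀ X ∈ carrier, ∀ X' ∈ carrier, ∃ Y ∈ carrier, X.Dom Y ∧ X'.Dom Y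
  nonempty : carrier.Nonempty
  closed : ∀ X : MMSpace, (∀ ε : ℝ≥0∞, 0 < ε → ∃ Y ∈ carrier, X.boxDist Y < ε) → X ∈ carrier

namespace Pyramid

theorem mem_iff_of_iso (P : Pyramid) {X Y : MMSpace} (h : X.Iso Y) :
    X ∈ P.carrier ↔ Y ∈ P.carrier := by
  obtain ⟨f, hf⟩ := h
  refine ⟨fun hX => P.down X hX Y ⟨f, f.isometry.lipschitz, hf⟩,
    fun hY => P.down Y hY X ⟨f.symm, f.symm.isometry.lipschitz, ?_⟩⟩
  rw [← hf, Measure.map_map f.symm.continuous.measurable f.continuous.measurable]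
  simp [Function.comp_def]

/-- Weak convergence of a sequence of pyramids. -/
def WeaklyConverges (Pn : ℕ → Pyramid) (P : Pyramid) : Prop :=
  (∀ X ∈ P.carrier, Tendsto (fun n => X.boxDistTo (Pn n).carrier) atTop (𝓝 0)) ∧
  (∀ X ∉ P.carrier, 0 < liminf (fun n => X.boxDistTo (Pn n).carrier) atTop)

/-- The observable diameter `ObsDiam(P; -κ)` of a pyramid, a limit as `δ → 0+` in `[0,∞]`
(it exists, see `Pyramid.tendsto_obsDiam`). -/
noncomputable def obsDiam (P : Pyramid) (κ : ℝ) : ℝ≥0∞ :=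
  limUnder (𝓝[>] (0 : ℝ)) fun δ => ⨆ X ∈ P.carrier, X.obsDiam (κ + δ)

/-- The separation distance `Sep(P; κ₀, …, κ_N)` of a pyramid, a limit as `δ → 0+` in `[0,∞]`
(it exists, see `Pyramid.tendsto_sep`). -/
noncomputable def sep (P : Pyramid) {N : ℕ} (κ : Fin (N + 1) → ℝ) : ℝ≥0∞ :=
  limUnder (𝓝[>] (0 : ℝ)) fun δ => ⨆ X ∈ P.carrier, X.sep fun i => κ i - δ

theorem tendsto_obsDiam (P : Pyramid) (κ : ℝ) :
    Tendsto (fun δ => ⨆ X ∈ P.carrier, X.obsDiam (κ + δ)) (𝓝[>] (0 : ℝ)) (𝓝 (P.obsDiam κ)) := by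
  have h : Antitone fun δ : ℝ => ⨆ X ∈ P.carrier, X.obsDiam (κ + δ) := fun a b hab =>
    iSup₂_mono fun X _ => X.obsDiam_antitone (by linarith)
  exact tendsto_nhds_limUnder ⟨_, h.tendsto_nhdsGT 0⟩

theorem tendsto_sep (P : Pyramid) {N : ℕ} (κ : Fin (N + 1) → ℝ) :
    Tendsto (fun δ => ⨆ X ∈ P.carrier, X.sep fun i => κ i - δ) (𝓝[>] (0 : ℝ))
      (𝓝 (P.sep κ)) := by
  have h : Monotone fun δ : ℝ => ⨆ X ∈ P.carrier, X.sep fun i => κ i - δ := fun a b hab =>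
    iSup₂_mono fun X _ => X.sep_antitone (fun i => by simp only; linarith)
  exact tendsto_nhds_limUnder ⟨_, h.tendsto_nhdsGT 0⟩

end Pyramid

/-!
Both formulas rest on two facts: the invariants are semicontinuous for the box distance, and laws of
`1`-Lipschitz maps to a fixed compact metric space are precompact for it.

**Semicontinuity.** If `X` and `Y` are `ε`-close in the box sense, then
`ObsDiam(X; -(κ + ε)) ≤ ObsDiam(Y; -κ) + 2ε` (`BoxClose.obsDiam_le`: a `1`-Lipschitz function is
transferred by McShane's formula) and `Sep(X; κ) ≤ Sep(Y; κ - ε) + ε` (`BoxClose.sep_le`: the sets are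
transferred through the parameters). As every member of `P` is approximated by members of the `Pn n`,
this bounds the invariants of `P` by the lower limits.

**Compactness.** For the upper limits, suppose that members `X n` of infinitely many `Pn n` have a
large invariant. Each `X n` is mapped by a `1`-Lipschitz map to one compact space `K` so that the law
`ν n` on `K` remembers the invariant; the support of `ν n` is again a member of `Pn n`. Coding `K` by
a copy of the Cantor set in `[0,1]`, quantile functions and Helly's theorem give almost everywhere
convergent representations on `[0,1)` of a subsequence (`MMSpace.exists_subseq_tendsto_ae`), and
Egorov's theorem turns these into box convergence. The box limit lies in `P`
(`Pyramid.WeaklyConverges.exists_limit`) and, by semicontinuity, has a large invariant.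

For the separation distance, `K` is a cube and the map consists of truncated distances to the
separated sets (`exists_lipschitz_cube`). For the observable diameter, `K` is an interval. Laws on
`ℝ` need not be tight, even after translation; `exists_lipschitz_compression` squeezes them into a
bounded interval without losing the partial diameter.
-/

/-! ### Selection of monotone functions and quantile functions -/

/-- **Helly's selection theorem** for `[0,1]`-valued functions. The limit `g` is the supremum of the
diagonal limit over a countable dense set, so that convergence is only claimed where `g` is
continuous, hence outside a countable set. -/
theorem exists_subseq_tendsto_of_monotone {α : Type*} [LinearOrder α] [TopologicalSpace α]
    [OrderTopology α] [TopologicalSpace.SeparableSpace α] [DenselyOrdered α] [NoMaxOrder α]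
    (f : ℕ → α → unitInterval) (hf : ∀ n, Monotone (f n)) :
    ∃ (g : α → unitInterval) (k : ℕ → ℕ), Monotone g ∧ StrictMono k ∧
      ∀ s, ContinuousAt g s → Tendsto (fun n => f (k n) s) atTop (𝓝 (g s)) := by
  obtain ⟨D, hDc, hDd⟩ := TopologicalSpace.exists_countable_dense α
  have := hDc.to_subtype
  obtain ⟨l, k, hk, hl⟩ := CompactSpace.tendsto_subseq fun n => fun d : D => f n d
  rw [tendsto_pi_nhds] at hl
  refine ⟨fun s => sSup {x | ∃ d : D, (d : α) ≤ s ∧ l d = x}, k, ?_, hk, ?_⟩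
  · rintro s t hst
    refine sSup_le_sSup ?_
    rintro _ ⟨d, hd, rfl⟩
    exact ⟨d, hd.trans hst, rfl⟩
  · intro s hs
    refine tendsto_order.2 ⟨fun a ha => ?_, fun b hb => ?_⟩
    · obtain ⟨_, ⟨d, hd, rfl⟩, had⟩ := lt_sSup_iff.1 ha
      filter_upwards [(hl d).eventually (lt_mem_nhds had)] with n hn
      exact lt_of_lt_of_le hn (hf _ hd)
    · have h1 : ∀ᶠ t in 𝓝[>] s, sSup {x | ∃ d : D, (d : α) ≤ t ∧ l d = x} < b :=
        (hs.eventually (gt_mem_nhds hb)).filter_mono nhdsWithin_le_nhds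
      obtain ⟨u, hu, hsub⟩ := (mem_nhdsGT_iff_exists_Ioo_subset).1 h1
      obtain ⟨d, hd, hdD⟩ := hDd.exists_mem_open isOpen_Ioo (nonempty_Ioo.2 hu)
      have h2 : l ⟨d, hd⟩ < b :=
        lt_of_le_of_lt (le_sSup (mem_ofPred.2 ⟨⟨d, hd⟩, le_rfl, rfl⟩)) (hsub hdD)
      filter_upwards [(hl ⟨d, hd⟩).eventually (gt_mem_nhds h2)] with n hn
      exact lt_of_le_of_lt (hf _ hdD.1.le) hn

namespace MMSpace

theorem measurableEmbedding_val_unitI : MeasurableEmbedding (Subtype.val : UnitI → ℝ) :=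
  MeasurableEmbedding.subtype_coe measurableSet_Ico

instance : IsProbabilityMeasure lebI := by
  constructor
  rw [lebI, measurableEmbedding_val_unitI.comap_apply, image_univ, Subtype.range_coe]
  simp

instance : NullSingletonClass lebI := by
  constructor
  intro x
  rw [lebI, measurableEmbedding_val_unitI.comap_apply]
  simp

theorem lebI_setOf_le {a : ℝ} (h1 : a ≤ 1) :
    lebI {s | (s : ℝ) ≤ a} = ENNReal.ofReal a := by
  have hset : Subtype.val '' {s : UnitI | (s : ℝ) ≤ a} = Ico 0 1 ∩ Iic a := by
    ext x; simp [and_comm]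
  rw [lebI, measurableEmbedding_val_unitI.comap_apply, hset]
  refine le_antisymm ?_ ?_
  · calc _ ≤ volume (Icc 0 a) := measure_mono fun x hx => mem_Icc.2 ⟨hx.1.1, hx.2⟩
      _ = _ := by simp
  · calc ENNReal.ofReal a = volume (Ico 0 a) := by simp
      _ ≤ _ := measure_mono fun x hx =>
        mem_inter (mem_Ico.2 ⟨hx.1, hx.2.trans_le h1⟩) (mem_Iic.2 hx.2.le)

/-- The quantile function of a measure on `[0,1]`: the monotone map `[0,1) → [0,1]` that pushes
Lebesgue measure forward to `ρ`. Since the infimum is taken in the complete lattice `[0,1]`, it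
has no junk value. -/
noncomputable def quantile (ρ : Measure unitInterval) (s : UnitI) : unitInterval :=
  sInf {x | (s : ℝ) ≤ ρ.real (Iic x)}

theorem monotone_quantile (ρ : Measure unitInterval) : Monotone (quantile ρ) :=
  fun _ _ hst => sInf_le_sInf fun _ hx => le_trans (Subtype.coe_le_coe.2 hst) hx.out

theorem quantile_le_iff (ρ : Measure unitInterval) [IsProbabilityMeasure ρ] (s : UnitI)
    (x : unitInterval) : quantile ρ s ≤ x ↔ (s : ℝ) ≤ ρ.real (Iic x) := by
  refine ⟨fun h => ?_, fun h => sInf_le h⟩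
  -- At the right end point there is nothing to the right of `x` to approximate by.
  by_cases hx : x = 1
  · have : Iic x = univ := by ext y; simpa [hx] using unitInterval.le_one' (t := y)
    rw [this]
    simpa using s.2.2.le
  have hnebot : (𝓝[>] x).NeBot :=
    nhdsGT_neBot_of_exists_gt ⟨1, lt_of_le_of_ne x.2.2 hx⟩
  have hcont : Tendsto (fun y : unitInterval => ρ.real (Iic y)) (𝓝[>] x) (𝓝 (ρ.real (Iic x))) := by
    have h1 := continuousWithinAt_Ioi_iff_Ici.mpr
      ((ProbabilityTheory.cdf (ρ.map Subtype.val)).right_continuous (x : ℝ))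
    have h2 : ∀ y : unitInterval, ProbabilityTheory.cdf (ρ.map Subtype.val) y = ρ.real (Iic y) := by
      intro y
      rw [ProbabilityTheory.unitInterval.cdf_eq_real]
      congr 1
      ext z
      simp
    simp_rw [← h2]
    exact h1.tendsto.comp (tendsto_nhdsWithin_iff.2 ⟨(by fun_prop : Continuous
      (Subtype.val : unitInterval → ℝ)).continuousAt.tendsto.mono_left nhdsWithin_le_nhds,
      eventually_nhdsWithin_of_forall fun y hy => hy⟩)
  refine ge_of_tendsto hcont (eventually_nhdsWithin_of_forall fun y hy => ?_)
  obtain ⟨z, hz, hzy⟩ := sInf_lt_iff.1 (lt_of_le_of_lt h hy)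
  exact le_trans hz (measureReal_mono (Iic_subset_Iic.2 hzy.le))

theorem map_quantile (ρ : Measure unitInterval) [IsProbabilityMeasure ρ] :
    lebI.map (quantile ρ) = ρ := by
  have hm : Measurable (quantile ρ) := (monotone_quantile ρ).measurable
  have := Measure.isProbabilityMeasure_map (μ := lebI) hm.aemeasurable
  refine Measure.ext_of_Iic _ _ fun x => ?_
  rw [Measure.map_apply hm measurableSet_Iic]
  have : quantile ρ ⁻¹' Iic x = {s : UnitI | (s : ℝ) ≤ ρ.real (Iic x)} := by
    ext s; exact quantile_le_iff ρ s x
  rw [this, lebI_setOf_le measureReal_le_one, ofReal_measureReal]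

/-! ### Almost sure representation on compact spaces -/

/-- A compact metric space is coded measurably by a closed subset `C` of `[0,1]` (a copy of the
Cantor set): `p` is continuous on `C`, and `σ` picks the least point of each fibre of `p` in `C`.
The sublevel sets of `σ` are images of compact sets under `p`, so `σ` is Borel. -/
theorem exists_cantor_coding (K : Type*) [MetricSpace K] [CompactSpace K] [Nonempty K]
    [MeasurableSpace K] [BorelSpace K] :
    ∃ (C : Set unitInterval) (p : unitInterval → K) (σ : K → unitInterval), IsClosed C ∧
      ContinuousOn p C ∧ Measurable p ∧ Measurable σ ∧ (∀ x, σ x ∈ C) ∧ ∀ x, p (σ x) = x := by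
  obtain ⟨c, hc, hsurj⟩ := exists_nat_bool_continuous_surjective_of_compact K
  obtain ⟨k₀⟩ := ‹Nonempty K›
  classical
  let C : Set unitInterval := Subtype.val ⁻¹' cantorSet
  have hC : IsClosed C := isClosed_cantorSet.preimage continuous_subtype_val
  let p' : C → K := fun x => c (cantorSetHomeomorphNatToBool ⟨x.1.1, x.2⟩)
  have hp' : Continuous p' := by fun_prop
  let p : unitInterval → K := fun x => if h : x ∈ C then p' ⟨x, h⟩ else k₀
  have hpC : ∀ x : C, p x = p' x := fun x => by simp [p]
  have hcont : ContinuousOn p C := by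
    rw [continuousOn_iff_continuous_domRestrict]
    exact hp'.congr fun x => (hpC x).symm
  have hfib : ∀ x, (C ∩ p ⁻¹' {x}).Nonempty := by
    intro x
    obtain ⟨b, hb⟩ := hsurj x
    let z := cantorSetHomeomorphNatToBool.symm b
    refine ⟨⟨z, cantorSet_subset_unitInterval z.2⟩, z.2, ?_⟩
    have := hpC ⟨⟨z, cantorSet_subset_unitInterval z.2⟩, z.2⟩
    simp only [mem_preimage, mem_singleton_iff]
    rw [this, ← hb]
    simp [p', z]
  have hmem : ∀ x, sInf (C ∩ p ⁻¹' {x}) ∈ C ∩ p ⁻¹' {x} := fun x =>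
    (hcont.preimage_isClosed_of_isClosed hC isClosed_singleton).isCompact.sInf_mem (hfib x)
  refine ⟨C, p, fun x => sInf (C ∩ p ⁻¹' {x}), hC, hcont, ?_, ?_, fun x => (hmem x).1,
    fun x => (hmem x).2⟩
  · exact Measurable.dite hp'.measurable measurable_const hC.measurableSet
  · refine measurable_of_Iic fun a => ?_
    have : (fun x => sInf (C ∩ p ⁻¹' {x})) ⁻¹' Iic a = p '' (C ∩ Iic a) := by
      ext x
      refine ⟨fun h => (mem_image _ _ _).2 ⟨_, mem_inter (hmem x).1 h, (hmem x).2⟩, ?_⟩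
      rintro ⟨y, ⟨hyC, hya⟩, rfl⟩
      exact mem_preimage.2 (mem_Iic.2 (le_trans (sInf_le (mem_inter hyC (by simp))) hya))
    rw [this]
    exact ((hC.inter isClosed_Iic).isCompact.image_of_continuousOn
      (hcont.mono inter_subset_left)).isClosed.measurableSet

/-- A form of Prokhorov's and Skorokhod's theorems: probability measures on a compact metric space
have a subsequence that is represented on `[0,1)` by almost everywhere convergent maps. Coding the
space by a closed subset of `[0,1]` reduces this to Helly's theorem for quantile functions. -/
theorem exists_subseq_tendsto_ae {K : Type*} [MetricSpace K] [CompactSpace K]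
    [MeasurableSpace K] [BorelSpace K] (ν : ℕ → Measure K) [∀ n, IsProbabilityMeasure (ν n)] :
    ∃ (k : ℕ → ℕ) (φ : ℕ → UnitI → K) (φ' : UnitI → K), StrictMono k ∧
      (∀ n, Measurable (φ n)) ∧ Measurable φ' ∧ (∀ n, lebI.map (φ n) = ν (k n)) ∧
      ∀ᵐ s ∂lebI, Tendsto (fun n => φ n s) atTop (𝓝 (φ' s)) := by
  have : Nonempty K := (inferInstance : (ae (ν 0)).NeBot).nonempty
  obtain ⟨C, p, σ, hC, hpC, hp, hσ, hσC, hpσ⟩ := exists_cantor_coding K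
  have hprob : ∀ n, IsProbabilityMeasure ((ν n).map σ) := fun n =>
    Measure.isProbabilityMeasure_map hσ.aemeasurable
  have hqm : ∀ n, Measurable (quantile ((ν n).map σ)) := fun n => (monotone_quantile _).measurable
  obtain ⟨q, k, hq, hk, hlim⟩ := exists_subseq_tendsto_of_monotone
    (fun n => quantile ((ν n).map σ)) (fun n => monotone_quantile _)
  refine ⟨k, fun n s => p (quantile ((ν (k n)).map σ) s), fun s => p (q s), hk,
    fun n => hp.comp (hqm _), hp.comp hq.measurable, fun n => ?_, ?_⟩
  · have h1 := Measure.map_map (μ := lebI) hp (hqm (k n))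
    rw [map_quantile, Measure.map_map hp hσ] at h1
    rw [Function.comp_def, Function.comp_def] at h1
    simp only [hpσ] at h1
    rw [← h1]
    exact Measure.map_id
  · have hmem : ∀ n, ∀ᵐ s ∂lebI, quantile ((ν n).map σ) s ∈ C := by
      intro n
      refine ae_of_ae_map (p := fun x => x ∈ C) (hqm n).aemeasurable ?_
      rw [map_quantile]
      rw [ae_map_iff (p := fun x => x ∈ C) hσ.aemeasurable (by simpa using hC.measurableSet)]
      exact Eventually.of_forall hσC
    filter_upwards [ae_all_iff.2 hmem, hq.countable_not_continuousAt.ae_notMem lebI] with s hs hc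
    have h1 := hlim s (by simpa using hc)
    have h2 : q s ∈ C := hC.mem_of_tendsto h1 (Eventually.of_forall fun n => hs _)
    exact (hpC _ h2).tendsto.comp
      (tendsto_nhdsWithin_iff.2 ⟨h1, Eventually.of_forall fun n => hs _⟩)

end MMSpace

namespace MMSpace

/-! ### The mm-space carried by the support of a measure -/

theorem map_comap_support {K : Type*} [TopologicalSpace K] [SecondCountableTopology K]
    [MeasurableSpace K] [BorelSpace K] (ν : Measure K) :
    (ν.comap (Subtype.val : ν.support → K)).map Subtype.val = ν := by
  have h : ∀ᵐ x ∂ν, x ∈ ν.support := Measure.support_mem_ae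
  rw [map_comap_subtype_coe Measure.isClosed_support.measurableSet,
    Measure.restrict_eq_self_of_ae_mem h]

/-- The mm-space carried by the support of a probability measure `ν` on `K`. Passing to the
support makes the measure fully supported, as mm-spaces require. -/
noncomputable def ofMeasure {K : Type} [MetricSpace K] [CompleteSpace K]
    [TopologicalSpace.SeparableSpace K] [MeasurableSpace K] [BorelSpace K] (ν : Measure K)
    [IsProbabilityMeasure ν] : MMSpace :=
  have : SecondCountableTopology K := UniformSpace.secondCountable_of_separable K
  have hmap := map_comap_support ν
  { carrier := ν.support
    complete := Measure.isClosed_support.completeSpace_coe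
    μ := ν.comap Subtype.val
    prob := by
      constructor
      have h := congrArg (fun m : Measure K => m univ) hmap
      rw [Measure.map_apply measurable_subtype_coe MeasurableSet.univ] at h
      simpa using h
    fullSupport := by
      constructor
      rintro U hU ⟨x, hx⟩
      obtain ⟨V, hV, rfl⟩ := isOpen_induced_iff.1 hU
      rw [← Measure.map_apply measurable_subtype_coe hV.measurableSet, hmap]
      exact ((Measure.mem_support_iff_forall _).1 x.2 V (hV.mem_nhds hx)).ne' }

section

variable {K : Type} [MetricSpace K] [CompleteSpace K] [TopologicalSpace.SeparableSpace K]
  [MeasurableSpace K] [BorelSpace K] (ν : Measure K) [IsProbabilityMeasure ν]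

/-- The inclusion of the mm-space `ofMeasure ν` into the ambient space `K`. -/
def inclusion : ofMeasure ν → K := Subtype.val

theorem isometry_inclusion : Isometry (inclusion ν) := isometry_subtype_coe

theorem measurable_inclusion : Measurable (inclusion ν) :=
  (isometry_inclusion ν).continuous.measurable

theorem map_inclusion : (ofMeasure ν).μ.map (inclusion ν) = ν := by
  have : SecondCountableTopology K := UniformSpace.secondCountable_of_separable K
  exact map_comap_support ν

variable {ν}

/-- A map of law `ν` with values in the support of `ν` lifts to the mm-space `ofMeasure ν`. -/
theorem exists_lift {α : Type*} [MeasurableSpace α] {m : Measure α} {f : α → K}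
    (hf : Measurable f) (hm : m.map f = ν) (hs : ∀ x, f x ∈ ν.support) :
    ∃ g : α → ofMeasure ν, Measurable g ∧ m.map g = (ofMeasure ν).μ ∧
      ∀ x, inclusion ν (g x) = f x := by
  have he : MeasurableEmbedding (inclusion ν) :=
    MeasurableEmbedding.subtype_coe Measure.isClosed_support.measurableSet
  choose g hgf using fun x => (⟨⟨f x, hs x⟩, rfl⟩ : ∃ y, inclusion ν y = f x)
  have hcomp : inclusion ν ∘ g = f := funext hgf
  have hg : Measurable g := he.measurable_comp_iff.1 (hcomp ▸ hf)
  refine ⟨g, hg, ?_, hgf⟩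
  rw [← he.comap_map (m.map _), ← he.comap_map (ofMeasure ν).μ, map_inclusion,
    Measure.map_map he.measurable hg, hcomp, hm]

theorem dom_ofMeasure {X : MMSpace} {f : X → K} (hf : LipschitzWith 1 f)
    (hν : X.μ.map f = ν) : (ofMeasure ν).Dom X := by
  have hs : ∀ x, f x ∈ ν.support := by
    intro x
    refine (Measure.mem_support_iff_forall _).2 fun U hU => ?_
    obtain ⟨V, hVU, hV, hxV⟩ := mem_nhds_iff.1 hU
    refine lt_of_lt_of_le ?_ (measure_mono hVU)
    rw [← hν, Measure.map_apply hf.continuous.measurable hV.measurableSet]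
    exact (hV.preimage hf.continuous).measure_pos _ ⟨x, hxV⟩
  obtain ⟨g, -, hgμ, hg⟩ := exists_lift hf.continuous.measurable hν hs
  refine ⟨g, fun x y => ?_, hgμ⟩
  rw [← (isometry_inclusion ν).edist_eq, hg, hg]
  exact hf x y

/-- A map `[0,1) → K` of law `ν` takes values in the support of `ν` almost everywhere, so it becomes
a parameter of `ofMeasure ν` after modification on a null set. -/
theorem exists_isParameter_ofMeasure {φ : UnitI → K} (hφ : Measurable φ)
    (hν : lebI.map φ = ν) :
    ∃ ψ : UnitI → ofMeasure ν, (ofMeasure ν).IsParameter ψ ∧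
      ∀ᵐ s ∂lebI, inclusion ν (ψ s) = φ s := by
  have : SecondCountableTopology K := UniformSpace.secondCountable_of_separable K
  classical
  have hS : MeasurableSet ν.support := Measure.isClosed_support.measurableSet
  obtain ⟨x₀, hx₀⟩ := Measure.nonempty_support (IsProbabilityMeasure.ne_zero ν)
  let f : UnitI → K := fun s => if φ s ∈ ν.support then φ s else x₀
  have hf : Measurable f := Measurable.ite (hφ hS) hφ measurable_const
  have hae : ∀ᵐ s ∂lebI, f s = φ s := by
    have h1 : ∀ᵐ x ∂(lebI.map φ), x ∈ ν.support := by
      rw [hν]; exact Measure.support_mem_ae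
    filter_upwards [ae_of_ae_map (p := fun x => x ∈ ν.support) hφ.aemeasurable h1] with s hs
    simp [f, hs]
  have hfs : ∀ s, f s ∈ ν.support := by
    intro s
    by_cases h : φ s ∈ ν.support <;> simp [f, h, hx₀]
  obtain ⟨ψ, hψ, hψμ, hψf⟩ := exists_lift hf ((Measure.map_congr hae).trans hν) hfs
  exact ⟨ψ, ⟨hψ, hψμ⟩, hae.mono fun s hs => (hψf s).trans hs⟩

end

/-! ### Box-close mm-spaces -/

theorem BoxClose.symm {X Y : MMSpace} {ε : ℝ≥0} (h : BoxClose X Y ε) : BoxClose Y X ε := by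
  obtain ⟨φ, ψ, I₀, hφ, hψ, hI, hd, hl⟩ := h
  exact ⟨ψ, φ, I₀, hψ, hφ, hI, fun s hs t ht => by rw [abs_sub_comm]; exact hd s hs t ht, hl⟩

theorem BoxClose.mono {X Y : MMSpace} {ε δ : ℝ≥0} (h : BoxClose X Y ε) (hεδ : ε ≤ δ) :
    BoxClose X Y δ := by
  obtain ⟨φ, ψ, I₀, hφ, hψ, hI, hd, hl⟩ := h
  exact ⟨φ, ψ, I₀, hφ, hψ, hI, fun s hs t ht => (hd s hs t ht).trans (by exact_mod_cast hεδ),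
    (tsub_le_tsub_left (by exact_mod_cast hεδ) 1).trans hl⟩

/-- Almost everywhere convergence of representing maps implies box convergence, by Egorov's
theorem. -/
theorem eventually_boxClose_of_tendsto_ae {K : Type} [MetricSpace K] [CompleteSpace K]
    [TopologicalSpace.SeparableSpace K] [MeasurableSpace K] [BorelSpace K] {ν : ℕ → Measure K}
    {ν' : Measure K} [∀ n, IsProbabilityMeasure (ν n)] [IsProbabilityMeasure ν']
    {φ : ℕ → UnitI → K} {φ' : UnitI → K} (hφ : ∀ n, Measurable (φ n)) (hφ' : Measurable φ')
    (hν : ∀ n, lebI.map (φ n) = ν n) (hν' : lebI.map φ' = ν')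
    (hlim : ∀ᵐ s ∂lebI, Tendsto (fun n => φ n s) atTop (𝓝 (φ' s))) {ε : ℝ≥0} (hε : 0 < ε) :
    ∀ᶠ n in atTop, BoxClose (ofMeasure (ν n)) (ofMeasure ν') ε := by
  have : SecondCountableTopology K := UniformSpace.secondCountable_of_separable K
  choose ψ hψ hψφ using fun n => exists_isParameter_ofMeasure (hφ n) (hν n)
  obtain ⟨ψ', hψ', hψφ'⟩ := exists_isParameter_ofMeasure hφ' hν'
  have hlim' : ∀ᵐ s ∂lebI,
      Tendsto (fun n => inclusion (ν n) (ψ n s)) atTop (𝓝 (inclusion ν' (ψ' s))) := by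
    filter_upwards [hlim, ae_all_iff.2 hψφ, hψφ'] with s h1 h2 h3
    simpa only [h2, h3] using h1
  obtain ⟨t, ht, htε, hunif⟩ := tendstoUniformlyOn_of_ae_tendsto'
    (fun n => ((measurable_inclusion (ν n)).comp (hψ n).1).stronglyMeasurable)
    ((measurable_inclusion ν').comp hψ'.1).stronglyMeasurable hlim' (ε := (ε : ℝ) / 2)
    (by positivity)
  filter_upwards [Metric.tendstoUniformlyOn_iff.1 hunif ((ε : ℝ) / 2) (by positivity)] with n hn
  refine ⟨ψ n, ψ', tᶜ, hψ n, hψ', ht.compl, fun a ha b hb => ?_, ?_⟩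
  · rw [← (isometry_inclusion (ν n)).dist_eq, ← (isometry_inclusion ν').dist_eq]
    have h1 := hn a ha
    have h2 := hn b hb
    simp only [Function.comp_apply] at h1 h2
    rw [dist_comm] at h1 h2
    have h3 := dist_dist_dist_le (inclusion (ν n) (ψ n a)) (inclusion (ν n) (ψ n b))
      (inclusion ν' (ψ' a)) (inclusion ν' (ψ' b))
    rw [Real.dist_eq] at h3
    linarith
  · rw [prob_compl_eq_one_sub ht]
    refine tsub_le_tsub_left (htε.trans ?_) 1
    rw [← ENNReal.ofReal_coe_nnreal]
    exact ENNReal.ofReal_le_ofReal (by linarith [ε.coe_nonneg])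

end MMSpace

namespace Pyramid

open MMSpace

/-! ### Weak limits and compactness -/

theorem exists_boxClose_of_boxDist_lt {X Y : MMSpace} {ε : ℝ≥0} (h : X.boxDist Y < ε) :
    BoxClose X Y ε := by
  simp only [boxDist, iInf_lt_iff] at h
  obtain ⟨δ, hδ, hlt⟩ := h
  exact hδ.mono (by exact_mod_cast hlt.le)

theorem WeaklyConverges.eventually_exists_boxClose {Pn : ℕ → Pyramid} {P : Pyramid}
    (hconv : WeaklyConverges Pn P) {X : MMSpace} (hX : X ∈ P.carrier) {ε : ℝ≥0} (hε : 0 < ε) :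
    ∀ᶠ n in atTop, ∃ Y ∈ (Pn n).carrier, BoxClose X Y ε := by
  have h0 : (0 : ℝ≥0∞) < ε := by exact_mod_cast hε
  filter_upwards [(hconv.1 X hX).eventually (gt_mem_nhds h0)] with n hn
  simp only [boxDistTo, iInf_lt_iff] at hn
  obtain ⟨Y, hY, hlt⟩ := hn
  exact ⟨Y, hY, exists_boxClose_of_boxDist_lt hlt⟩

/-- An mm-space to which members of infinitely many `Pn n` come arbitrarily close belongs to the
weak limit. A subsequence suffices, because the `liminf` in the definition of weak convergence is
positive outside the limit. -/
theorem WeaklyConverges.mem_of_frequently {Pn : ℕ → Pyramid} {P : Pyramid}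
    (hconv : WeaklyConverges Pn P) {X : MMSpace}
    (h : ∀ ε : ℝ≥0, 0 < ε → ∃ᶠ n in atTop, ∃ Y ∈ (Pn n).carrier, BoxClose X Y ε) :
    X ∈ P.carrier := by
  by_contra hX
  obtain ⟨ε, hε, hlt⟩ := ENNReal.lt_iff_exists_nnreal_btwn.1 (hconv.2 X hX)
  have hε' : 0 < ε := by exact_mod_cast hε
  refine hlt.not_ge (liminf_le_of_frequently_le' ((h ε hε').mono ?_))
  rintro n ⟨Y, hY, hc⟩
  exact (iInf₂_le Y hY).trans (iInf₂_le ε hc)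

/-- The compactness principle behind both upper bounds: if infinitely many `Pn n` have a member with
a `1`-Lipschitz map to a fixed compact space `K` whose law satisfies `Q`, then the weak limit has a
member that is a box limit of mm-spaces `ofMeasure ν` with `Q ν`. -/
theorem WeaklyConverges.exists_limit {Pn : ℕ → Pyramid} {P : Pyramid}
    (hconv : WeaklyConverges Pn P) {K : Type} [MetricSpace K] [CompactSpace K]
    [MeasurableSpace K] [BorelSpace K] (Q : Measure K → Prop)
    (h : ∃ᶠ n in atTop, ∃ X ∈ (Pn n).carrier, ∃ f : X → K, LipschitzWith 1 f ∧ Q (X.μ.map f)) :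
    ∃ Y ∈ P.carrier, ∀ ε : ℝ≥0, 0 < ε →
      ∃ (ν : Measure K) (_ : IsProbabilityMeasure ν), Q ν ∧ BoxClose (ofMeasure ν) Y ε := by
  obtain ⟨k, hk, hX⟩ := extraction_of_frequently_atTop h
  choose X hXP f hf hQ using hX
  have hprob : ∀ n, IsProbabilityMeasure ((X n).μ.map (f n)) := fun n =>
    Measure.isProbabilityMeasure_map (hf n).continuous.aemeasurable
  obtain ⟨l, φ, φ', hl, hφ, hφ', hφν, hlim⟩ := exists_subseq_tendsto_ae fun n => (X n).μ.map (f n)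
  have hprob' : IsProbabilityMeasure (lebI.map φ') :=
    Measure.isProbabilityMeasure_map hφ'.aemeasurable
  have hclose : ∀ ε : ℝ≥0, 0 < ε → ∀ᶠ n in atTop,
      BoxClose (ofMeasure ((X (l n)).μ.map (f (l n)))) (ofMeasure (lebI.map φ')) ε := fun ε hε =>
    eventually_boxClose_of_tendsto_ae hφ hφ' hφν rfl hlim hε
  refine ⟨ofMeasure (lebI.map φ'), hconv.mem_of_frequently fun ε hε => ?_, fun ε hε => ?_⟩
  · refine (hk.comp hl).tendsto_atTop.frequently ((hclose ε hε).frequently.mono fun n hn => ?_)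
    exact ⟨_, (Pn _).down _ (hXP _) _ (dom_ofMeasure (hf _) rfl), hn.symm⟩
  · obtain ⟨n, hn⟩ := (hclose ε hε).exists
    exact ⟨_, hprob _, hQ _, hn⟩

end Pyramid

/-! ### Lipschitz functions as infima -/

theorem lipschitzWith_one_iInf {E ι : Type*} [PseudoMetricSpace E] {F : ι → E → ℝ}
    (hF : ∀ i, LipschitzWith 1 (F i)) (hb : ∀ x, BddBelow (range fun i => F i x)) :
    LipschitzWith 1 fun x => ⨅ i, F i x := by
  refine LipschitzWith.of_le_add fun x y => ?_
  rcases isEmpty_or_nonempty ι with h | h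
  · simp
  · rw [← sub_le_iff_le_add]
    refine le_ciInf fun i => ?_
    have h1 := (hF i).le_add_mul x y
    have h2 := ciInf_le (hb x) i
    simp only [NNReal.coe_one, one_mul] at h1
    linarith

namespace MMSpace

/-! ### Semicontinuity under box convergence -/

theorem ofReal_sub_le_lebI_inter {I₀ S : Set UnitI} (hI : MeasurableSet I₀) {ε : ℝ≥0} {a : ℝ}
    (hε : 1 - (ε : ℝ≥0∞) ≤ lebI I₀) (ha : ENNReal.ofReal a ≤ lebI S) :
    ENNReal.ofReal (a - ε) ≤ lebI (I₀ ∩ S) := by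
  rw [ENNReal.ofReal_sub _ ε.coe_nonneg, ENNReal.ofReal_coe_nnreal, tsub_le_iff_right]
  calc ENNReal.ofReal a ≤ lebI S := ha
    _ ≤ lebI (S ∩ I₀) + lebI (S \ I₀) := measure_le_inter_add_sdiff _ _ _
    _ ≤ lebI (I₀ ∩ S) + ε := by
      rw [inter_comm]
      gcongr
      calc lebI (S \ I₀) ≤ lebI I₀ᶜ := measure_mono fun x hx => hx.2
        _ = 1 - lebI I₀ := prob_compl_eq_one_sub hI
        _ ≤ ε := tsub_le_iff_tsub_le.1 hε

/-- A `1`-Lipschitz function on `X` is transferred to `Y`, up to the distortion `ε` of the relation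
between `φ` and `ψ` on `I₀`, by McShane's formula `g y = inf (f (φ s) + d(y, ψ s))`. -/
theorem exists_lipschitz_transfer {α : Type*} {X Y : Type*} [PseudoMetricSpace X]
    [PseudoMetricSpace Y] {φ : α → X} {ψ : α → Y} {I₀ : Set α} {ε : ℝ}
    (hd : ∀ s ∈ I₀, ∀ t ∈ I₀, |dist (φ s) (φ t) - dist (ψ s) (ψ t)| ≤ ε) {f : X → ℝ}
    (hf : LipschitzWith 1 f) :
    ∃ g : Y → ℝ, LipschitzWith 1 g ∧ ∀ s ∈ I₀, |f (φ s) - g (ψ s)| ≤ ε := by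
  have hkey : ∀ t ∈ I₀, ∀ s ∈ I₀, ∀ y,
      f (φ t) - ε - dist (ψ t) y ≤ f (φ s) + dist y (ψ s) := by
    intro t ht s hs y
    have h1 := hf.le_add_mul (φ t) (φ s)
    have h2 := (abs_le.1 (hd t ht s hs)).2
    have h3 := dist_triangle (ψ t) y (ψ s)
    simp only [NNReal.coe_one, one_mul] at h1
    linarith
  have hb : ∀ y, BddBelow (range fun s : I₀ => f (φ s) + dist y (ψ s)) := by
    intro y
    rcases I₀.eq_empty_or_nonempty with rfl | ⟨t, ht⟩
    · simp
    · exact ⟨f (φ t) - ε - dist (ψ t) y, by rintro _ ⟨s, rfl⟩; exact hkey t ht s s.2 y⟩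
  refine ⟨fun y => ⨅ s : I₀, (f (φ s) + dist y (ψ s)), lipschitzWith_one_iInf (fun s => ?_) hb,
    fun s hs => ?_⟩
  · exact LipschitzWith.of_le_add fun x y => by linarith [dist_triangle x y (ψ s)]
  · have : Nonempty I₀ := ⟨⟨s, hs⟩⟩
    have h1 : ⨅ r : I₀, (f (φ r) + dist (ψ s) (ψ r)) ≤ f (φ s) + dist (ψ s) (ψ s) :=
      ciInf_le (hb (ψ s)) ⟨s, hs⟩
    have h2 : f (φ s) - ε - dist (ψ s) (ψ s) ≤ ⨅ r : I₀, (f (φ r) + dist (ψ s) (ψ r)) :=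
      le_ciInf fun r => hkey s hs r r.2 (ψ s)
    have h3 : 0 ≤ ε := (abs_nonneg _).trans (hd s hs s hs)
    rw [dist_self] at h1 h2
    exact abs_le.2 ⟨by linarith, by linarith⟩

theorem BoxClose.obsDiam_le {X Y : MMSpace} {ε : ℝ≥0} (h : BoxClose X Y ε) (κ : ℝ) :
    X.obsDiam (κ + ε) ≤ Y.obsDiam κ + 2 * ε := by
  obtain ⟨φ, ψ, I₀, hφ, hψ, hI, hd, hl⟩ := h
  refine iSup₂_le fun f hf => ?_
  obtain ⟨g, hg, hfg⟩ := exists_lipschitz_transfer hd hf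
  refine le_trans ?_ (add_le_add_left (le_iSup₂ (f := fun (f : Y → ℝ) (_ : LipschitzWith 1 f) =>
    partialDiam (Y.μ.map f) (1 - κ)) g hg) _)
  simp only [partialDiam, ENNReal.iInf_add]
  refine le_iInf₂ fun B hB => ?_
  refine (iInf₂_le (Metric.cthickening ε B) ⟨Metric.isClosed_cthickening.measurableSet, ?_⟩).trans
    (Metric.ediam_cthickening_le ε)
  have hBm := hB.2
  rw [← hψ.2, Measure.map_map hg.continuous.measurable hψ.1,
    Measure.map_apply (hg.continuous.measurable.comp hψ.1) hB.1] at hBm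
  rw [← hφ.2, Measure.map_map hf.continuous.measurable hφ.1,
    Measure.map_apply (hf.continuous.measurable.comp hφ.1)
      Metric.isClosed_cthickening.measurableSet]
  have h1 := ofReal_sub_le_lebI_inter hI hl hBm
  rw [sub_sub] at h1
  refine h1.trans (measure_mono fun s hs => ?_)
  exact Metric.mem_cthickening_of_dist_le _ (g (ψ s)) _ _ hs.2 (by
    rw [Real.dist_eq]; exact hfg s hs.1)

theorem BoxClose.sep_le {X Y : MMSpace} {ε : ℝ≥0} (h : BoxClose X Y ε) {N : ℕ}
    (κ : Fin (N + 1) → ℝ) : X.sep κ ≤ Y.sep (fun i => κ i - ε) + ε := by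
  obtain ⟨φ, ψ, I₀, hφ, hψ, hI, hd, hl⟩ := h
  refine iSup₂_le fun A hA => ?_
  let B : Fin (N + 1) → Set Y := fun i => closure (ψ '' (I₀ ∩ φ ⁻¹' A i))
  have hB : ∀ i, MeasurableSet (B i) ∧ ENNReal.ofReal (κ i - ε) ≤ Y.μ (B i) := by
    intro i
    refine ⟨isClosed_closure.measurableSet, ?_⟩
    have h1 := (hA i).2
    rw [← hφ.2, Measure.map_apply hφ.1 (hA i).1] at h1
    rw [← hψ.2, Measure.map_apply hψ.1 isClosed_closure.measurableSet]
    exact (ofReal_sub_le_lebI_inter hI hl h1).trans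
      (measure_mono fun s hs => subset_closure (mem_image_of_mem ψ hs))
  refine le_trans ?_ (add_le_add_left (le_iSup₂ (f := fun (A : Fin (N + 1) → Set Y)
    (_ : ∀ i, MeasurableSet (A i) ∧ ENNReal.ofReal (κ i - ε) ≤ Y.μ (A i)) =>
    ⨅ (i : Fin (N + 1)) (j : Fin (N + 1)) (_ : i ≠ j), Y.setDist (A i) (A j)) B hB) _)
  simp only [ENNReal.iInf_add]
  refine le_iInf fun i => le_iInf fun j => le_iInf fun hij => ?_
  refine (iInf_le_of_le i (iInf_le_of_le j (iInf_le _ hij))).trans ?_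
  simp only [setDist, ENNReal.iInf_add]
  refine le_iInf₂ fun y hy => le_iInf₂ fun y' hy' => ?_
  have hcl : IsClosed {p : Y × Y | X.setDist (A i) (A j) ≤ edist p.1 p.2 + ε} :=
    isClosed_le continuous_const (continuous_edist.add continuous_const)
  have hsub : (ψ '' (I₀ ∩ φ ⁻¹' A i)) ×ˢ (ψ '' (I₀ ∩ φ ⁻¹' A j)) ⊆
      {p : Y × Y | X.setDist (A i) (A j) ≤ edist p.1 p.2 + ε} := by
    rintro ⟨_, _⟩ ⟨⟨s, hs, rfl⟩, ⟨t, ht, rfl⟩⟩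
    have hst : X.setDist (A i) (A j) ≤ edist (φ s) (φ t) :=
      iInf₂_le_of_le (φ s) hs.2 (iInf₂_le (φ t) ht.2)
    refine hst.trans ?_
    rw [edist_dist, edist_dist, ← ENNReal.ofReal_coe_nnreal (p := ε),
      ← ENNReal.ofReal_add dist_nonneg ε.coe_nonneg]
    exact ENNReal.ofReal_le_ofReal (by linarith [(abs_le.1 (hd s hs.1 t ht.1)).2])
  have hmem : (y, y') ∈ closure ((ψ '' (I₀ ∩ φ ⁻¹' A i)) ×ˢ (ψ '' (I₀ ∩ φ ⁻¹' A j))) := by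
    rw [closure_prod_eq]; exact ⟨hy, hy'⟩
  exact closure_minimal hsub hcl hmem

/-! ### Invariants of measures on compact spaces -/

theorem partialDiam_le_obsDiam_ofMeasure {K : Type} [MetricSpace K] [CompleteSpace K]
    [TopologicalSpace.SeparableSpace K] [MeasurableSpace K] [BorelSpace K] (ν : Measure K)
    [IsProbabilityMeasure ν] {g : K → ℝ} (hg : LipschitzWith 1 g) (κ : ℝ) :
    partialDiam (ν.map g) (1 - κ) ≤ (ofMeasure ν).obsDiam κ := by
  have h := le_iSup₂ (f := fun (f : ofMeasure ν → ℝ) (_ : LipschitzWith 1 f) =>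
    partialDiam ((ofMeasure ν).μ.map f) (1 - κ)) (g ∘ inclusion ν)
    (by simpa using hg.comp (isometry_inclusion ν).lipschitz)
  rwa [← Measure.map_map hg.continuous.measurable (measurable_inclusion ν), map_inclusion] at h

theorem le_sep_ofMeasure {K : Type} [MetricSpace K] [CompleteSpace K]
    [TopologicalSpace.SeparableSpace K] [MeasurableSpace K] [BorelSpace K] (ν : Measure K)
    [IsProbabilityMeasure ν] {N : ℕ} {κ : Fin (N + 1) → ℝ} {B : Fin (N + 1) → Set K}
    (hB : ∀ i, MeasurableSet (B i)) (hκ : ∀ i, ENNReal.ofReal (κ i) ≤ ν (B i)) {D : ℝ≥0∞}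
    (hD : ∀ i j, i ≠ j → ∀ x ∈ B i, ∀ y ∈ B j, D ≤ edist x y) : D ≤ (ofMeasure ν).sep κ := by
  refine le_iSup₂_of_le (fun i => inclusion ν ⁻¹' B i)
    (fun i => ⟨measurable_inclusion ν (hB i), ?_⟩) ?_
  · rw [← Measure.map_apply (measurable_inclusion ν) (hB i), map_inclusion]
    exact hκ i
  · refine le_iInf fun i => le_iInf fun j => le_iInf fun hij => ?_
    refine le_iInf₂ fun x hx => le_iInf₂ fun y hy => ?_
    rw [← (isometry_inclusion ν).edist_eq]
    exact hD i j hij _ hx _ hy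

/-- Partial diameters of a measure on `ℝ` above `D` survive, up to a loss `2 * η` in mass, under a
`1`-Lipschitz map into an interval whose length depends on `D` and `η` alone.

The map is the largest `1`-Lipschitz function below `(D / η) • F`, where `F` is the distribution
function. It shrinks long intervals of small mass, but still separates the end points of every
interval of mass at least `α + η` by `D`: such an interval `[a, b]` cannot be crossed cheaply, since
a jump of `F` by `η` costs `D`, and an interval of mass `α` is longer than `D`. Truncation at a large
radius would not do, as mass may escape to infinity in several pieces. -/
theorem exists_lipschitz_compression (ν : Measure ℝ) [IsProbabilityMeasure ν] {D η α : ℝ}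
    (hD : 0 ≤ D) (hη : 0 < η) (hα : ENNReal.ofReal D < partialDiam ν α) :
    ∃ h : ℝ → ℝ, LipschitzWith 1 h ∧ (∀ x, h x ∈ Icc 0 (D / η)) ∧
      ENNReal.ofReal D ≤ partialDiam (ν.map h) (α + 2 * η) := by
  have hdiam : ∀ A, MeasurableSet A → ENNReal.ofReal α ≤ ν A → ENNReal.ofReal D < Metric.ediam A :=
    fun A hA hm => hα.trans_le (iInf₂_le A ⟨hA, hm⟩)
  have hα0 : 0 < α := by
    by_contra hneg
    have := hdiam ∅ MeasurableSet.empty (by simp [ENNReal.ofReal_of_nonpos (not_lt.1 hneg)])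
    simp at this
  have hIcc : ∀ a b, a ≤ b → α ≤ ν.real (Icc a b) → D < b - a := by
    intro a b hab hm
    have := hdiam (Icc a b) measurableSet_Icc (ENNReal.ofReal_le_of_le_toReal hm)
    rw [Real.ediam_Icc] at this
    exact (ENNReal.ofReal_lt_ofReal_iff_of_nonneg hD).1 this
  set L := D / η with hL
  have hL0 : 0 ≤ L := by positivity
  have hLη : L * η = D := by rw [hL]; field_simp
  -- The atom at `y` is left out, so that `F y - F a` is the mass of `[a, y)`, which together with
  -- `[y, b]` covers `[a, b]`.
  let F : ℝ → ℝ := fun y => ν.real (Iio y)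
  let G : ℝ → ℝ → ℝ := fun y x => |x - y| + L * F y
  have hG0 : ∀ y x, 0 ≤ G y x := fun y x => by positivity
  have hb : ∀ x, BddBelow (range fun y => G y x) := fun x =>
    ⟨0, by rintro _ ⟨y, rfl⟩; exact hG0 y x⟩
  let h : ℝ → ℝ := fun x => ⨅ y, G y x
  have hle : ∀ x y, h x ≤ G y x := fun x y => ciInf_le (hb x) y
  have hlip : LipschitzWith 1 h := by
    refine lipschitzWith_one_iInf (fun y => LipschitzWith.of_le_add fun a b => ?_) hb
    have := abs_sub_le a b y
    simp only [G, Real.dist_eq]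
    linarith
  have hLmono : ∀ p q : ℝ, p + η ≤ q → L * p + D ≤ L * q := fun p q hpq => by
    have := mul_le_mul_of_nonneg_left hpq hL0
    linarith
  have hgap : ∀ a b, a ≤ b → α + η ≤ ν.real (Icc a b) → h a + D ≤ h b := by
    intro a b hab hm
    refine le_ciInf fun y => ?_
    have hdisj : Disjoint (Iio a) (Icc a b) :=
      disjoint_left.2 fun x hx hx' => not_le.2 hx hx'.1
    have hunion : ν.real (Iio a ∪ Icc a b) = F a + ν.real (Icc a b) :=
      measureReal_union hdisj measurableSet_Icc
    have hself : h a ≤ L * F a := by simpa [G] using hle a a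
    rcases lt_or_ge y a with hya | hay
    · have h1 := hle a y
      have h2 := hIcc a b hab (by linarith)
      simp only [G] at h1 ⊢
      rw [abs_of_nonneg (by linarith)] at h1 ⊢
      linarith
    · rcases le_or_gt y b with hyb | hby
      · rcases le_or_gt α (ν.real (Icc y b)) with hy | hy
        · have h1 := hIcc y b hyb hy
          have h2 : L * F a ≤ L * F y :=
            mul_le_mul_of_nonneg_left (measureReal_mono (Iio_subset_Iio hay)) hL0
          simp only [G]
          rw [abs_of_nonneg (by linarith)]
          linarith
        · have h1 : ν.real (Iio a ∪ Icc a b) ≤ F y + ν.real (Icc y b) := by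
            refine (measureReal_mono fun x hx => ?_).trans (measureReal_union_le _ _)
            rcases lt_or_ge x y with hxy | hxy
            · exact Or.inl hxy
            · refine Or.inr ⟨hxy, ?_⟩
              rcases hx with hx | hx
              · exact absurd (hay.trans hxy) (not_le.2 hx)
              · exact hx.2
          have h2 := hLmono (F a) (F y) (by linarith)
          simp only [G]
          linarith [abs_nonneg (b - y)]
      · have h1 : ν.real (Iio a ∪ Icc a b) ≤ F y := by
          refine measureReal_mono fun x hx => ?_
          rcases hx with hx | hx
          · exact lt_of_lt_of_le hx hay
          · exact lt_of_le_of_lt hx.2 hby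
        have h2 := hLmono (F a) (F y) (by linarith)
        simp only [G]
        linarith [abs_nonneg (b - y)]
  refine ⟨h, hlip, fun x => ⟨le_ciInf fun y => hG0 y x, ?_⟩, ?_⟩
  · calc h x ≤ L * F x := by simpa [G] using hle x x
      _ ≤ L * 1 := mul_le_mul_of_nonneg_left measureReal_le_one hL0
      _ = L := mul_one L
  · refine le_iInf₂ fun A hA => ?_
    have hm := hA.2
    rw [Measure.map_apply hlip.continuous.measurable hA.1] at hm
    have hlt : ENNReal.ofReal (α + η) < ν (h ⁻¹' A) :=
      lt_of_lt_of_le ((ENNReal.ofReal_lt_ofReal_iff (by linarith)).2 (by linarith)) hm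
    -- A compact part of the preimage of `A` has extreme points, which both map into `A`.
    obtain ⟨C, hCA, hC, hCm⟩ :=
      (hlip.continuous.measurable hA.1).exists_lt_isCompact hlt
    have hne : C.Nonempty := by
      by_contra hempty
      rw [not_nonempty_iff_eq_empty.1 hempty] at hCm
      simp at hCm
    have ha := hC.sInf_mem hne
    have hb' := hC.sSup_mem hne
    have hsub : C ⊆ Icc (sInf C) (sSup C) := fun x hx =>
      ⟨csInf_le hC.bddBelow hx, le_csSup hC.bddAbove hx⟩
    have h1 : α + η ≤ ν.real (Icc (sInf C) (sSup C)) :=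
      (ENNReal.ofReal_le_iff_le_toReal (measure_ne_top _ _)).1
        (hCm.le.trans (measure_mono hsub))
    have h2 := hgap _ _ (hsub ha).2 h1
    calc ENNReal.ofReal D ≤ ENNReal.ofReal (dist (h (sSup C)) (h (sInf C))) := by
          refine ENNReal.ofReal_le_ofReal ?_
          rw [Real.dist_eq]
          exact le_trans (by linarith) (le_abs_self _)
      _ = edist (h (sSup C)) (h (sInf C)) := (edist_dist _ _).symm
      _ ≤ Metric.ediam A := Metric.edist_le_ediam_of_mem (hCA hb') (hCA ha)

/-- The truncated distances to sets `A i` that witness `D < X.sep κ` form a `1`-Lipschitz map to the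
cube `[0, D]^(N+1)`, whose sup metric keeps the images of the `A i` at distance `D`. Positivity of
the `κ i` makes the `A i` nonempty, so that the distances to them are meaningful. -/
theorem exists_lipschitz_cube {X : MMSpace} {N : ℕ} {κ : Fin (N + 1) → ℝ} (hκ : ∀ i, 0 < κ i)
    {D : ℝ≥0} (hD : D < X.sep κ) :
    ∃ f : X → Fin (N + 1) → Icc (0 : ℝ) D, LipschitzWith 1 f ∧
      ∀ i, ENNReal.ofReal (κ i) ≤ X.μ.map f {p | (p i : ℝ) = 0 ∧ ∀ j, j ≠ i → (p j : ℝ) = D} := by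
  simp only [sep, lt_iSup_iff] at hD
  obtain ⟨A, hA, hlt⟩ := hD
  have hne : ∀ i, (A i).Nonempty := by
    intro i
    refine nonempty_of_measure_ne_zero (μ := X.μ) (ne_of_gt (lt_of_lt_of_le ?_ (hA i).2))
    exact ENNReal.ofReal_pos.2 (hκ i)
  have hdist : ∀ i j, i ≠ j → ∀ x ∈ A i, ∀ y ∈ A j, (D : ℝ) ≤ dist x y := by
    intro i j hij x hx y hy
    have h1 : (D : ℝ≥0∞) ≤ edist x y := hlt.le.trans
      ((iInf_le_of_le i (iInf_le_of_le j (iInf_le _ hij))).trans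
        (iInf₂_le_of_le x hx (iInf₂_le y hy)))
    rw [edist_nndist] at h1
    exact_mod_cast h1
  let f : X → Fin (N + 1) → Icc (0 : ℝ) D := fun x i =>
    ⟨min (Metric.infDist x (A i)) D, le_min Metric.infDist_nonneg D.coe_nonneg, min_le_right _ _⟩
  have hf : LipschitzWith 1 f := by
    refine LipschitzWith.of_dist_le_mul fun x y => ?_
    rw [NNReal.coe_one, one_mul, dist_pi_le_iff dist_nonneg]
    intro i
    have := ((Metric.lipschitz_infDist_pt (A i)).min_const (D : ℝ)).dist_le_mul x y
    exact this.trans_eq (by simp)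
  refine ⟨f, hf, fun i => (hA i).2.trans ?_⟩
  refine le_trans (measure_mono fun x hx => ?_)
    (Measure.le_map_apply hf.continuous.measurable.aemeasurable _)
  refine ⟨?_, fun j hj => ?_⟩
  · simp [f, Metric.infDist_zero_of_mem hx]
  · exact min_eq_right ((Metric.le_infDist (hne j)).2 fun y hy => hdist i j hj.symm x hx y hy)

end MMSpace

theorem exists_nnreal_pos_le {η : ℝ≥0} {ε : ℝ} (hη : 0 < η) (hε : 0 < ε) :
    ∃ δ : ℝ≥0, 0 < δ ∧ 2 * (δ : ℝ≥0∞) ≤ η ∧ (δ : ℝ) ≤ ε := by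
  refine ⟨min (η / 2) ε.toNNReal, lt_min (by positivity) (Real.toNNReal_pos.2 hε), ?_, ?_⟩
  · have h1 : 2 * min (η / 2) ε.toNNReal ≤ η :=
      calc 2 * min (η / 2) ε.toNNReal ≤ 2 * (η / 2) := by gcongr; exact min_le_left _ _
        _ = η := mul_div_cancel₀ _ two_ne_zero
    exact_mod_cast h1
  · exact (NNReal.coe_le_coe.2 (min_le_right _ _)).trans_eq (Real.coe_toNNReal _ hε.le)

namespace Pyramid

open MMSpace

/-! ### Invariants of pyramids -/

theorem le_obsDiam (P : Pyramid) {X : MMSpace} (hX : X ∈ P.carrier) {κ κ' : ℝ} (h : κ < κ') :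
    X.obsDiam κ' ≤ P.obsDiam κ := by
  refine ge_of_tendsto (P.tendsto_obsDiam κ) ?_
  filter_upwards [Ioo_mem_nhdsGT (sub_pos.2 h)] with δ hδ
  exact (X.obsDiam_antitone (by linarith [hδ.2])).trans
    (le_iSup₂ (f := fun (X : MMSpace) (_ : X ∈ P.carrier) => X.obsDiam (κ + δ)) X hX)

theorem obsDiam_le (P : Pyramid) (κ : ℝ) : P.obsDiam κ ≤ ⨆ X ∈ P.carrier, X.obsDiam κ := by
  refine le_of_tendsto (P.tendsto_obsDiam κ) ?_
  filter_upwards [self_mem_nhdsWithin] with δ hδ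
  have hδ' : 0 < δ := hδ
  exact iSup₂_mono fun X _ => X.obsDiam_antitone (by linarith)

theorem le_sep (P : Pyramid) {X : MMSpace} (hX : X ∈ P.carrier) {N : ℕ} (κ : Fin (N + 1) → ℝ) :
    X.sep κ ≤ P.sep κ := by
  refine ge_of_tendsto (P.tendsto_sep κ) ?_
  filter_upwards [self_mem_nhdsWithin] with δ hδ
  have hδ' : 0 < δ := hδ
  have h1 : X.sep κ ≤ X.sep fun i => κ i - δ := X.sep_antitone fun i => by simp only; linarith
  exact h1.trans
    (le_iSup₂ (f := fun (X : MMSpace) (_ : X ∈ P.carrier) => X.sep fun i => κ i - δ) X hX)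

theorem sep_le (P : Pyramid) {N : ℕ} (κ : Fin (N + 1) → ℝ) {δ : ℝ} (hδ : 0 < δ) :
    P.sep κ ≤ ⨆ X ∈ P.carrier, X.sep fun i => κ i - δ := by
  refine le_of_tendsto (P.tendsto_sep κ) ?_
  filter_upwards [Ioo_mem_nhdsGT hδ] with δ' hδ'
  exact iSup₂_mono fun X _ => X.sep_antitone fun i => by simp only; linarith [hδ'.2]

variable {Pn : ℕ → Pyramid} {P : Pyramid}

theorem WeaklyConverges.iSup_obsDiam_le_liminf (hconv : WeaklyConverges Pn P) (κ : ℝ) {ε : ℝ}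
    (hε : 0 < ε) :
    ⨆ X ∈ P.carrier, X.obsDiam (κ + 2 * ε) ≤ liminf (fun n => (Pn n).obsDiam (κ + ε)) atTop := by
  refine iSup₂_le fun X hX => ENNReal.le_of_forall_pos_le_add fun η hη _ => ?_
  obtain ⟨δ, hδ, hδη, hδε⟩ := exists_nnreal_pos_le hη (half_pos hε)
  rw [← tsub_le_iff_right]
  refine le_liminf_of_le (by isBoundedDefault) ?_
  filter_upwards [hconv.eventually_exists_boxClose hX hδ] with n hn
  obtain ⟨Y, hY, hXY⟩ := hn
  rw [tsub_le_iff_right]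
  calc X.obsDiam (κ + 2 * ε) = X.obsDiam ((κ + 2 * ε - δ) + δ) := by rw [sub_add_cancel]
    _ ≤ Y.obsDiam (κ + 2 * ε - δ) + 2 * δ := hXY.obsDiam_le _
    _ ≤ (Pn n).obsDiam (κ + ε) + η := by
      gcongr
      exact (Pn n).le_obsDiam hY (by linarith)

theorem WeaklyConverges.limsup_obsDiam_le (hconv : WeaklyConverges Pn P) (κ : ℝ) {ε : ℝ}
    (hε : 0 < ε) :
    limsup (fun n => (Pn n).obsDiam (κ + ε)) atTop ≤ P.obsDiam κ := by
  refine ENNReal.le_of_forall_nnreal_lt fun D hD => ?_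
  -- The compression loses `2 * η` of the mass margin and the box limit at most `η` more, which
  -- leaves part of the margin `ε = 8 * η` for the strict inequality in `le_obsDiam`.
  set η := ε / 8 with hη
  have hη0 : 0 < η := by positivity
  obtain ⟨Y, hY, hYν⟩ := hconv.exists_limit (K := Icc (0 : ℝ) (D / η))
    (fun ν => (D : ℝ≥0∞) ≤ partialDiam (ν.map Subtype.val) (1 - (κ + ε) + 2 * η)) (by
      refine (frequently_lt_of_lt_limsup (by isBoundedDefault) hD).mono fun n hn => ?_
      have hn' := hn.trans_le ((Pn n).obsDiam_le _)
      simp only [lt_iSup_iff] at hn'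
      obtain ⟨X, hX, hDX⟩ := hn'
      simp only [MMSpace.obsDiam, lt_iSup_iff] at hDX
      obtain ⟨f, hf, hDf⟩ := hDX
      have := Measure.isProbabilityMeasure_map (μ := X.μ) hf.continuous.aemeasurable
      rw [← ENNReal.ofReal_coe_nnreal] at hDf
      obtain ⟨h, hh, hhI, hhD⟩ := exists_lipschitz_compression _ D.coe_nonneg hη0 hDf
      have hg : LipschitzWith 1 fun x => (⟨h (f x), hhI (f x)⟩ : Icc (0 : ℝ) (D / η)) := by
        have := hh.comp hf
        rw [mul_one] at this
        exact fun x y => this x y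
      refine ⟨X, hX, _, hg, ?_⟩
      rw [Measure.map_map measurable_subtype_coe hg.continuous.measurable]
      rwa [ENNReal.ofReal_coe_nnreal,
        Measure.map_map hh.continuous.measurable hf.continuous.measurable] at hhD)
  refine ENNReal.le_of_forall_pos_le_add fun δ hδ _ => ?_
  obtain ⟨θ, hθ, hθδ, hθη⟩ := exists_nnreal_pos_le hδ hη0
  obtain ⟨ν, _, hν, hbox⟩ := hYν _ hθ
  calc (D : ℝ≥0∞) ≤ partialDiam (ν.map Subtype.val) (1 - (κ + ε) + 2 * η) := hν
    _ = partialDiam (ν.map Subtype.val) (1 - (κ + 6 * η)) := by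
      congr 1; rw [hη]; ring
    _ ≤ (ofMeasure ν).obsDiam (κ + 6 * η) :=
      partialDiam_le_obsDiam_ofMeasure ν isometry_subtype_coe.lipschitz _
    _ = (ofMeasure ν).obsDiam ((κ + 6 * η - θ) + θ) := by rw [sub_add_cancel]
    _ ≤ Y.obsDiam (κ + 6 * η - θ) + 2 * θ := hbox.obsDiam_le _
    _ ≤ P.obsDiam κ + δ := by
      gcongr
      exact P.le_obsDiam hY (by linarith)

theorem WeaklyConverges.sep_le_liminf (hconv : WeaklyConverges Pn P) {N : ℕ}
    (κ : Fin (N + 1) → ℝ) {ε : ℝ} (hε : 0 < ε) :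
    P.sep κ ≤ liminf (fun n => (Pn n).sep fun i => κ i - ε) atTop := by
  refine (P.sep_le κ (half_pos hε)).trans
    (iSup₂_le fun X hX => ENNReal.le_of_forall_pos_le_add fun η hη _ => ?_)
  obtain ⟨δ, hδ, hδη', hδε⟩ := exists_nnreal_pos_le hη (half_pos hε)
  have hδη : (δ : ℝ≥0∞) ≤ η := (le_mul_of_one_le_left' one_le_two).trans hδη'
  rw [← tsub_le_iff_right]
  refine le_liminf_of_le (by isBoundedDefault) ?_
  filter_upwards [hconv.eventually_exists_boxClose hX hδ] with n hn
  obtain ⟨Y, hY, hXY⟩ := hn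
  rw [tsub_le_iff_right]
  calc (X.sep fun i => κ i - ε / 2) ≤ (Y.sep fun i => κ i - ε / 2 - δ) + δ := hXY.sep_le _
    _ ≤ (Y.sep fun i => κ i - ε) + η := by
      gcongr
      exact Y.sep_antitone fun i => by simp only; linarith
    _ ≤ (Pn n).sep (fun i => κ i - ε) + η := by
      gcongr
      exact (Pn n).le_sep hY _

theorem WeaklyConverges.limsup_sep_le (hconv : WeaklyConverges Pn P) {N : ℕ}
    (κ : Fin (N + 1) → ℝ) {ε : ℝ} (hε : 0 < ε) (hκ : ∀ i, 2 * ε < κ i) :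
    limsup (fun n => (Pn n).sep fun i => κ i - ε) atTop ≤
      ⨆ X ∈ P.carrier, X.sep fun i => κ i - 3 * ε := by
  refine ENNReal.le_of_forall_nnreal_lt fun D hD => ?_
  let B : Fin (N + 1) → Set (Fin (N + 1) → Icc (0 : ℝ) D) := fun i =>
    {p | (p i : ℝ) = 0 ∧ ∀ j, j ≠ i → (p j : ℝ) = D}
  obtain ⟨Y, hY, hYν⟩ := hconv.exists_limit (K := Fin (N + 1) → Icc (0 : ℝ) D)
    (fun ν => ∀ i, ENNReal.ofReal (κ i - 2 * ε) ≤ ν (B i)) (by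
      refine (frequently_lt_of_lt_limsup (by isBoundedDefault) hD).mono fun n hn => ?_
      have hn' := hn.trans_le ((Pn n).sep_le _ hε)
      simp only [lt_iSup_iff] at hn'
      obtain ⟨X, hX, hDX⟩ := hn'
      have hsub : (fun i => κ i - ε - ε) = fun i => κ i - 2 * ε := by ext i; ring
      rw [hsub] at hDX
      obtain ⟨f, hf, hfB⟩ := exists_lipschitz_cube (fun i => sub_pos.2 (hκ i)) hDX
      exact ⟨X, hX, f, hf, hfB⟩)
  refine ENNReal.le_of_forall_pos_le_add fun δ hδ _ => ?_
  obtain ⟨θ, hθ, hθδ', hθε⟩ := exists_nnreal_pos_le hδ hε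
  have hθδ : (θ : ℝ≥0∞) ≤ δ := (le_mul_of_one_le_left' one_le_two).trans hθδ'
  obtain ⟨ν, _, hν, hbox⟩ := hYν _ hθ
  have hBm : ∀ i, MeasurableSet (B i) := by
    intro i
    refine IsClosed.measurableSet ?_
    have h1 : B i = {p | (p i : ℝ) = 0} ∩ ⋂ j, ⋂ (_ : j ≠ i), {p | (p j : ℝ) = D} := by
      ext p; simp [B]
    rw [h1]
    refine (isClosed_eq (by fun_prop) continuous_const).inter
      (isClosed_iInter fun j => isClosed_iInter fun _ => isClosed_eq (by fun_prop) continuous_const)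
  have hBd : ∀ i j, i ≠ j → ∀ x ∈ B i, ∀ y ∈ B j, (D : ℝ≥0∞) ≤ edist x y := by
    intro i j hij x hx y hy
    refine le_trans ?_ (edist_le_pi_edist x y i)
    rw [Subtype.edist_eq, hx.1, hy.2 i hij, edist_dist, Real.dist_eq]
    simp
  calc (D : ℝ≥0∞) ≤ (ofMeasure ν).sep fun i => κ i - 2 * ε := le_sep_ofMeasure ν hBm hν hBd
    _ ≤ (Y.sep fun i => κ i - 2 * ε - θ) + θ := hbox.sep_le _
    _ ≤ (Y.sep fun i => κ i - 3 * ε) + δ := by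
      gcongr
      exact Y.sep_antitone fun i => by simp only; linarith
    _ ≤ (⨆ X ∈ P.carrier, X.sep fun i => κ i - 3 * ε) + δ := by
      gcongr
      exact le_iSup₂ (f := fun (X : MMSpace) (_ : X ∈ P.carrier) =>
        X.sep fun i => κ i - 3 * ε) Y hY

end Pyramid

theorem tendsto_const_mul_nhdsGT_zero {c : ℝ} (hc : 0 < c) :
    Tendsto (fun ε : ℝ => c * ε) (𝓝[>] 0) (𝓝[>] 0) := by
  refine tendsto_nhdsWithin_iff.2 ⟨?_, ?_⟩
  · have : Tendsto (fun ε : ℝ => c * ε) (𝓝 0) (𝓝 (c * 0)) := tendsto_id.const_mul c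
    rw [mul_zero] at this
    exact this.mono_left nhdsWithin_le_nhds
  · filter_upwards [self_mem_nhdsWithin] with ε hε
    exact mul_pos hc hε

theorem theorem1p1 (Pn : ℕ → Pyramid) (P : Pyramid) (hconv : Pyramid.WeaklyConverges Pn P) :
    (∀ κ : ℝ, 0 < κ →
      Tendsto (fun ε : ℝ => liminf (fun n => (Pn n).obsDiam (κ + ε)) atTop)
        (𝓝[>] (0 : ℝ)) (𝓝 (P.obsDiam κ)) ∧
      Tendsto (fun ε : ℝ => limsup (fun n => (Pn n).obsDiam (κ + ε)) atTop)
        (𝓝[>] (0 : ℝ)) (𝓝 (P.obsDiam κ))) ∧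
    (∀ N : ℕ, 1 ≤ N → ∀ κ : Fin (N + 1) → ℝ, (∀ i, 0 < κ i) →
      Tendsto (fun ε : ℝ => liminf (fun n => (Pn n).sep (fun i => κ i - ε)) atTop)
        (𝓝[>] (0 : ℝ)) (𝓝 (P.sep κ)) ∧
      Tendsto (fun ε : ℝ => limsup (fun n => (Pn n).sep (fun i => κ i - ε)) atTop)
        (𝓝[>] (0 : ℝ)) (𝓝 (P.sep κ))) := by
  refine ⟨fun κ _ => ?_, fun N _ κ hκ => ?_⟩
  · have hlow := (P.tendsto_obsDiam κ).comp (tendsto_const_mul_nhdsGT_zero two_pos)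
    have h1 : ∀ᶠ ε : ℝ in 𝓝[>] 0, ⨆ X ∈ P.carrier, X.obsDiam (κ + 2 * ε) ≤
        liminf (fun n => (Pn n).obsDiam (κ + ε)) atTop :=
      eventually_nhdsWithin_of_forall fun ε hε => hconv.iSup_obsDiam_le_liminf κ hε
    have h2 : ∀ᶠ ε : ℝ in 𝓝[>] 0, limsup (fun n => (Pn n).obsDiam (κ + ε)) atTop ≤
        P.obsDiam κ :=
      eventually_nhdsWithin_of_forall fun ε hε => hconv.limsup_obsDiam_le κ hε
    exact ⟨tendsto_of_tendsto_of_tendsto_of_le_of_le' hlow tendsto_const_nhds h1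
        (h2.mono fun ε hε => (liminf_le_limsup).trans hε),
      tendsto_of_tendsto_of_tendsto_of_le_of_le' hlow tendsto_const_nhds
        (h1.mono fun ε hε => hε.trans liminf_le_limsup) h2⟩
  · have hup := (P.tendsto_sep κ).comp (tendsto_const_mul_nhdsGT_zero three_pos)
    have hsmall : ∀ᶠ ε : ℝ in 𝓝[>] 0, ∀ i, 2 * ε < κ i := eventually_all.2 fun i =>
      ((tendsto_const_mul_nhdsGT_zero two_pos).mono_right nhdsWithin_le_nhds).eventually
        (gt_mem_nhds (hκ i))
    have h1 : ∀ᶠ ε : ℝ in 𝓝[>] 0, P.sep κ ≤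
        liminf (fun n => (Pn n).sep fun i => κ i - ε) atTop :=
      eventually_nhdsWithin_of_forall fun ε hε => hconv.sep_le_liminf κ hε
    have h2 : ∀ᶠ ε : ℝ in 𝓝[>] 0, limsup (fun n => (Pn n).sep fun i => κ i - ε) atTop ≤
        ⨆ X ∈ P.carrier, X.sep fun i => κ i - 3 * ε := by
      filter_upwards [hsmall, self_mem_nhdsWithin] with ε hε hε0
      exact hconv.limsup_sep_le κ hε0 hε
    exact ⟨tendsto_of_tendsto_of_tendsto_of_le_of_le' tendsto_const_nhds hup h1
        (h2.mono fun ε hε => (liminf_le_limsup).trans hε),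
      tendsto_of_tendsto_of_tendsto_of_le_of_le' tendsto_const_nhds hup
        (h1.mono fun ε hε => hε.trans liminf_le_limsup) h2⟩
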